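/- Let $T>0$ and $\alpha\in[0,1/2)$, and let $L^2([0,T],\mathbb{R})$ carry its usual norm $\|\cdot\|$. Let $u^e(t)=1$ for all $t\in[0,T]$, and let $\boldsymbol{u}^e:L^2([0,T],\mathbb{R})\to L^2([0,T],\mathbb{R})$ be the bounded integral operator $$(\boldsymbol{u}^e f)(t)=\int_0^t u^e(t-s)f(s)\,ds ,\qquad t\in[0,T],$$ with Hilbert-space adjoint $(\boldsymbol{u}^e)^*$. Let $G^\star\in L^2([0,T],\mathbb{R})$ be given by $G^\star(t)=t^{-\alpha}$ for $t\in(0,T]$, and for $R>0$ put $$\mathscr{D}(R)=\inf\{\|G^\star-(\boldsymbol{u}^e)^*v\| : v\in L^2([0,T],\mathbb{R}),\ \|v\|\le R\}.$$ Then $$\limsup_{R\to\infty}\mathscr{D}(R)\,R^{\frac{1-2\alpha}{1+2\alpha}}<\infty,$$ and for every real $\varepsilon>\frac{1-2\alpha}{1+2\alpha}$, $$\limsup_{R\to\infty}\mathscr{D}(R)\,R^{\varepsilon}=\infty .$$ -/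

import Mathlib

noncomputable section

open MeasureTheory Set Filter

namespace PropagatorEstimation

/-- Lebesgue measure on the interval `[0, T]`. -/
abbrev leb (T : ℝ) : Measure ℝ := volume.restrict (Icc 0 T)

/-- The real Hilbert space `L²([0, T], ℝ)`. -/
abbrev L2 (T : ℝ) : Type := Lp ℝ 2 (leb T)

/-- The causal convolution `t ↦ ∫₀ᵗ u(t - s) f(s) ds` of two elements of `L²([0, T], ℝ)`.
For `t ∈ [0, T]` only the values of `u` and `f` on `[0, T]` enter. -/
def volterraFun {T : ℝ} (u f : L2 T) (t : ℝ) : ℝ :=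
  ∫ s in (0 : ℝ)..t, u (t - s) * f s

theorem memLp_left {T t : ℝ} (u : L2 T) (ht : t ∈ Icc 0 T) :
    MemLp (fun s => u (t - s)) 2 (volume.restrict (Ioc 0 t)) ∧
      eLpNorm (fun s => u (t - s)) 2 (volume.restrict (Ioc 0 t)) ≤ eLpNorm u 2 (leb T) := by
  have hpre : (fun s : ℝ => t - s) ⁻¹' (Ico 0 t) = Ioc 0 t := by
    ext s
    simp only [mem_preimage, mem_Ico, mem_Ioc]
    constructor <;> rintro ⟨h1, h2⟩ <;> constructor <;> linarith
  have hmp : MeasurePreserving (fun s : ℝ => t - s) (volume.restrict (Ioc 0 t))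
      (volume.restrict (Ico 0 t)) := by
    rw [← hpre]
    exact (Measure.measurePreserving_sub_left volume t).restrict_preimage measurableSet_Ico
  have hle : volume.restrict (Ico 0 t) ≤ leb T :=
    Measure.restrict_mono_set volume
      (show Ico 0 t ⊆ Icc 0 T from fun s hs => ⟨hs.1, hs.2.le.trans ht.2⟩)
  have hu : MemLp u 2 (volume.restrict (Ico 0 t)) := (Lp.memLp u).mono_measure hle
  refine ⟨hu.comp_measurePreserving hmp, ?_⟩
  have h := eLpNorm_comp_measurePreserving (p := 2) hu.1 hmp
  calc eLpNorm (fun s => u (t - s)) 2 (volume.restrict (Ioc 0 t))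
      = eLpNorm u 2 (volume.restrict (Ico 0 t)) := h
    _ ≤ _ := eLpNorm_mono_measure _ hle

theorem restrict_Ioc_le {T t : ℝ} (ht : t ∈ Icc 0 T) : volume.restrict (Ioc 0 t) ≤ leb T :=
  Measure.restrict_mono_set volume
    (show Ioc 0 t ⊆ Icc 0 T from fun _ hs => ⟨hs.1.le, hs.2.trans ht.2⟩)

theorem intervalIntegrable_volterra {T t : ℝ} (u f : L2 T) (ht : t ∈ Icc 0 T) :
    IntervalIntegrable (fun s => u (t - s) * f s) volume 0 t := by
  rw [intervalIntegrable_iff_integrableOn_Ioc_of_le ht.1]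
  exact (memLp_left u ht).1.integrable_mul ((Lp.memLp f).mono_measure (restrict_Ioc_le ht))

theorem volterraFun_bound {T t : ℝ} (u f : L2 T) (ht : t ∈ Icc 0 T) :
    ‖volterraFun u f t‖ ≤ ‖u‖ * ‖f‖ := by
  have hf : MemLp f 2 (volume.restrict (Ioc 0 t)) :=
    (Lp.memLp f).mono_measure (restrict_Ioc_le ht)
  have h1 : eLpNorm (fun s => u (t - s) * f s) 1 (volume.restrict (Ioc 0 t))
      ≤ eLpNorm u 2 (leb T) * eLpNorm f 2 (leb T) := by
    have := eLpNorm_smul_le_mul_eLpNorm (p := 2) (q := 2) (r := 1) hf.1 (memLp_left u ht).1.1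
    calc _ ≤ _ := this
      _ ≤ _ := mul_le_mul' (memLp_left u ht).2 (eLpNorm_mono_measure _ (restrict_Ioc_le ht))
  rw [volterraFun, intervalIntegral.integral_of_le ht.1]
  have h2 := enorm_integral_le_lintegral_enorm (μ := volume.restrict (Ioc 0 t))
    (fun s => u (t - s) * f s)
  rw [← eLpNorm_one_eq_lintegral_enorm] at h2
  have h3 := ENNReal.toReal_mono
    (ENNReal.mul_ne_top (Lp.eLpNorm_ne_top u) (Lp.eLpNorm_ne_top f)) (h2.trans h1)
  rw [ENNReal.toReal_mul] at h3
  simpa [Lp.norm_def] using h3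

theorem aestronglyMeasurable_volterraFun {T : ℝ} (u f : L2 T) :
    AEStronglyMeasurable (volterraFun u f) (leb T) := by
  have hA : MeasurableSet {p : ℝ × ℝ | 0 < p.2 ∧ p.2 ≤ p.1} :=
    (measurableSet_lt measurable_const measurable_snd).inter
      (measurableSet_le measurable_snd measurable_fst)
  have hm : StronglyMeasurable ({p : ℝ × ℝ | 0 < p.2 ∧ p.2 ≤ p.1}.indicator
      (fun p : ℝ × ℝ => u (p.1 - p.2) * f p.2)) :=
    (((Lp.stronglyMeasurable u).comp_measurable (measurable_fst.sub measurable_snd)).mul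
      ((Lp.stronglyMeasurable f).comp_measurable measurable_snd)).indicator hA
  refine ⟨_, hm.integral_prod_right' (ν := volume), ?_⟩
  filter_upwards [ae_restrict_mem measurableSet_Icc] with t ht
  rw [volterraFun, intervalIntegral.integral_of_le ht.1, ← integral_indicator measurableSet_Ioc]
  rfl

theorem memLp_volterraFun {T : ℝ} (u f : L2 T) : MemLp (volterraFun u f) 2 (leb T) := by
  refine MemLp.of_bound (aestronglyMeasurable_volterraFun u f) (‖u‖ * ‖f‖) ?_
  filter_upwards [ae_restrict_mem measurableSet_Icc] with t ht
  exact volterraFun_bound u f ht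

theorem volterraFun_congr {T t : ℝ} (u f : L2 T) {g : ℝ → ℝ} (h : f =ᵐ[leb T] g)
    (ht : t ∈ Icc 0 T) : volterraFun u f t = ∫ s in (0 : ℝ)..t, u (t - s) * g s := by
  rw [volterraFun, intervalIntegral.integral_of_le ht.1, intervalIntegral.integral_of_le ht.1]
  refine integral_congr_ae ?_
  filter_upwards [ae_mono (restrict_Ioc_le ht) h] with s hs
  simp only [hs]

theorem volterraFun_add {T t : ℝ} (u f g : L2 T) (ht : t ∈ Icc 0 T) :
    volterraFun u (f + g) t = volterraFun u f t + volterraFun u g t := by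
  rw [volterraFun_congr u _ (Lp.coeFn_add f g) ht, volterraFun, volterraFun,
    ← intervalIntegral.integral_add (intervalIntegrable_volterra u f ht)
      (intervalIntegrable_volterra u g ht)]
  simp only [Pi.add_apply, mul_add]

theorem volterraFun_smul {T t : ℝ} (u : L2 T) (c : ℝ) (f : L2 T) (ht : t ∈ Icc 0 T) :
    volterraFun u (c • f) t = c * volterraFun u f t := by
  rw [volterraFun_congr u _ (Lp.coeFn_smul c f) ht, volterraFun,
    ← intervalIntegral.integral_const_mul]
  simp only [Pi.smul_apply, smul_eq_mul, mul_left_comm]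

/-- The bounded integral operator `𝐮 : L²([0, T], ℝ) → L²([0, T], ℝ)` given by
`(𝐮 f)(t) = ∫₀ᵗ u(t - s) f(s) ds`. -/
def volterraOp {T : ℝ} (u : L2 T) : L2 T →L[ℝ] L2 T :=
  LinearMap.mkContinuous
    { toFun := fun f => (memLp_volterraFun u f).toLp (volterraFun u f)
      map_add' := fun f g => by
        rw [← MemLp.toLp_add, MemLp.toLp_eq_toLp_iff]
        filter_upwards [ae_restrict_mem measurableSet_Icc] with t ht
        exact volterraFun_add u f g ht
      map_smul' := fun c f => by
        rw [RingHom.id_apply, ← MemLp.toLp_const_smul, MemLp.toLp_eq_toLp_iff]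
        filter_upwards [ae_restrict_mem measurableSet_Icc] with t ht
        exact volterraFun_smul u c f ht }
    ((measureUnivNNReal (leb T) : ℝ) ^ ((2 : ENNReal).toReal)⁻¹ * ‖u‖)
    (fun f => by
      rw [mul_assoc]
      refine Lp.norm_le_of_ae_bound (by positivity) ?_
      filter_upwards [(memLp_volterraFun u f).coeFn_toLp,
        ae_restrict_mem measurableSet_Icc] with t h ht
      simp only [LinearMap.coe_mk, AddHom.coe_mk]
      rw [h]
      exact volterraFun_bound u f ht)

/-- The distance function
`𝒟(R) = inf {‖G - 𝐮* v‖ : v ∈ L²([0, T], ℝ), ‖v‖ ≤ R}`, where `𝐮*` is the Hilbert-space adjoint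
of the integral operator `𝐮`. -/
def distFun {T : ℝ} (u G : L2 T) (R : ℝ) : ℝ :=
  sInf {d : ℝ | ∃ v : L2 T, ‖v‖ ≤ R ∧ d = ‖G - ContinuousLinearMap.adjoint (volterraOp u) v‖}

end PropagatorEstimation

end

open MeasureTheory Set Filter

namespace PropagatorEstimation

/-! For `u = 1` the adjoint is the backward primitive `v ↦ ∫ t in s..T, v t`, so its range consists
of the `H¹` functions vanishing at `T`. The target `t ^ (-α)` leaves this range at both ends: it is
singular at `0` when `α > 0`, and its value at `T` is nonzero.

Upper bound (`exists_approximant`): freezing the power on `(0, δ]` costs norm of order `δ ^ (-(1 +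
2α) / 2)` and leaves an error of order `δ ^ ((1 - 2α) / 2)`; a linear layer of width `η` at `T`
costs `1 / √η` and leaves `√η`. Spending about `R / 2` on each gives the errors `R ^ (-(1 - 2α) / (1
+ 2α))` and `R⁻¹`, and the first dominates.

Lower bound (`inner_sub_le_distFun_mul`): any `φ` satisfies `‖φ‖ ‖G - 𝐮* v‖ ≥ ⟪φ, G⟫ - R ‖𝐮 φ‖` when
`‖v‖ ≤ R`. A `φ` living at scale `δ`, with `𝐮 φ` confined to the same interval, has `‖φ‖ ≤ δ ^
(1/2)`, `‖𝐮 φ‖ ≤ δ ^ (3/2)` and pairing at least `c δ ^ (1 - α)`; balancing the last two gives the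
same exponent. -/

theorem integrable_coeFn {T : ℝ} (f : L2 T) : Integrable f (leb T) :=
  (Lp.memLp f).integrable one_le_two

/-! ### The operator and its adjoint as primitives -/

/-- For the constant kernel `1` the causal convolution is the primitive. -/
theorem volterraFun_eq_primitive {T t : ℝ} {u : L2 T} (hu : ∀ᵐ t ∂leb T, u t = 1) (f : L2 T)
    (ht : t ∈ Icc 0 T) : volterraFun u f t = ∫ s in (0 : ℝ)..t, f s := by
  have hpre : (fun s : ℝ => t - s) ⁻¹' (Ico 0 t) = Ioc 0 t := by
    ext s
    simp only [mem_preimage, mem_Ico, mem_Ioc]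
    constructor <;> rintro ⟨h1, h2⟩ <;> constructor <;> linarith
  have hmp : MeasurePreserving (fun s : ℝ => t - s) (volume.restrict (Ioc 0 t))
      (volume.restrict (Ico 0 t)) := by
    rw [← hpre]
    exact (Measure.measurePreserving_sub_left volume t).restrict_preimage measurableSet_Ico
  have hle : volume.restrict (Ico 0 t) ≤ leb T :=
    Measure.restrict_mono_set volume
      (show Ico 0 t ⊆ Icc 0 T from fun s hs => ⟨hs.1, hs.2.le.trans ht.2⟩)
  rw [volterraFun, intervalIntegral.integral_of_le ht.1, intervalIntegral.integral_of_le ht.1]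
  refine integral_congr_ae ?_
  filter_upwards [hmp.quasiMeasurePreserving.ae (ae_mono hle hu)] with s hs
  rw [hs, one_mul]

theorem volterraOp_ae_eq_primitive {T : ℝ} {u : L2 T} (hu : ∀ᵐ t ∂leb T, u t = 1) (f : L2 T) :
    ∀ᵐ t ∂leb T, volterraOp u f t = ∫ s in (0 : ℝ)..t, f s := by
  filter_upwards [(memLp_volterraFun u f).coeFn_toLp, ae_restrict_mem measurableSet_Icc]
    with t h ht
  rw [← volterraFun_eq_primitive hu f ht]
  exact h

theorem memLp_primitive_left {T : ℝ} (hT : 0 ≤ T) (v : L2 T) :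
    MemLp (fun s => ∫ t in s..T, v t) 2 (leb T) := by
  have hc : ContinuousOn (fun s => ∫ t in s..T, v t) (Icc 0 T) := by
    have := intervalIntegral.continuousOn_primitive_interval_left (a := 0) (b := T)
      (μ := volume) (f := v) (by rw [uIcc_of_le hT]; exact integrable_coeFn v)
    rwa [uIcc_of_le hT] at this
  obtain ⟨C, hC⟩ := isCompact_Icc.exists_bound_of_continuousOn hc
  refine MemLp.of_bound (hc.aestronglyMeasurable measurableSet_Icc) C ?_
  filter_upwards [ae_restrict_mem measurableSet_Icc] with t ht using hC t ht

/-- For the constant kernel `1` the adjoint is the backward primitive. -/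
theorem adjoint_volterraOp_ae_eq_primitive {T : ℝ} (hT : 0 ≤ T) {u : L2 T}
    (hu : ∀ᵐ t ∂leb T, u t = 1) (v : L2 T) :
    ∀ᵐ s ∂leb T, ContinuousLinearMap.adjoint (volterraOp u) v s = ∫ t in s..T, v t := by
  suffices h : ContinuousLinearMap.adjoint (volterraOp u) v =
      (memLp_primitive_left hT v).toLp _ by
    rw [h]
    exact (memLp_primitive_left hT v).coeFn_toLp
  refine ext_inner_left ℝ fun f => ?_
  rw [ContinuousLinearMap.adjoint_inner_right, L2.inner_def, L2.inner_def]
  have hA : MeasurableSet {p : ℝ × ℝ | p.2 < p.1} :=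
    measurableSet_lt measurable_snd measurable_fst
  -- Fubini on the triangle `s < t`: both inner products are iterated integrals of `v t * f s` over
  -- it.
  have hint : Integrable (Function.uncurry fun t s : ℝ =>
      {p : ℝ × ℝ | p.2 < p.1}.indicator (fun p => v p.1 * f p.2) (t, s))
      ((leb T).prod (leb T)) :=
    ((integrable_coeFn v).mul_prod (integrable_coeFn f)).indicator hA
  have hswap := integral_integral_swap hint
  have hleft : ∀ᵐ t ∂leb T, inner ℝ (volterraOp u f t) (v t) =
      ∫ s, {p : ℝ × ℝ | p.2 < p.1}.indicator (fun p => v p.1 * f p.2) (t, s) ∂leb T := by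
    filter_upwards [volterraOp_ae_eq_primitive hu f, ae_restrict_mem measurableSet_Icc]
      with t h ht
    have hi : (fun s => {p : ℝ × ℝ | p.2 < p.1}.indicator (fun p => v p.1 * f p.2) (t, s)) =
        (Iio t).indicator (fun s => v t * f s) := rfl
    have hs : Iio t ∩ Icc 0 T = Ico 0 t := by
      ext s
      simp only [mem_inter_iff, mem_Iio, mem_Icc, mem_Ico]
      constructor
      · rintro ⟨h1, h2, h3⟩; exact ⟨h2, h1⟩
      · rintro ⟨h1, h2⟩; exact ⟨h2, h1, h2.le.trans ht.2⟩
    rw [hi, integral_indicator measurableSet_Iio, Measure.restrict_restrict measurableSet_Iio,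
      hs, integral_const_mul, h, intervalIntegral.integral_of_le ht.1,
      integral_Ico_eq_integral_Ioo, ← integral_Ioc_eq_integral_Ioo]
    simp
  have hright : ∀ᵐ s ∂leb T, inner ℝ (f s) ((memLp_primitive_left hT v).toLp _ s) =
      ∫ t, {p : ℝ × ℝ | p.2 < p.1}.indicator (fun p => v p.1 * f p.2) (t, s) ∂leb T := by
    filter_upwards [(memLp_primitive_left hT v).coeFn_toLp, ae_restrict_mem measurableSet_Icc]
      with s h ht
    have hi : (fun t => {p : ℝ × ℝ | p.2 < p.1}.indicator (fun p => v p.1 * f p.2) (t, s)) =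
        (Ioi s).indicator (fun t => v t * f s) := rfl
    have hs : Ioi s ∩ Icc 0 T = Ioc s T := by
      ext t
      simp only [mem_inter_iff, mem_Ioi, mem_Icc, mem_Ioc]
      constructor
      · rintro ⟨h1, h2, h3⟩; exact ⟨h1, h3⟩
      · rintro ⟨h1, h2⟩; exact ⟨h1, ht.1.trans h1.le, h2⟩
    rw [hi, integral_indicator measurableSet_Ioi, Measure.restrict_restrict measurableSet_Ioi,
      hs, integral_mul_const, h, intervalIntegral.integral_of_le ht.2]
    simp
  rw [integral_congr_ae hleft, integral_congr_ae hright, hswap]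

/-! ### Bounding the distance function from above and below -/

theorem distFun_le {T : ℝ} (u G v : L2 T) {R : ℝ} (hv : ‖v‖ ≤ R) :
    distFun u G R ≤ ‖G - ContinuousLinearMap.adjoint (volterraOp u) v‖ :=
  csInf_le ⟨0, by rintro _ ⟨w, -, rfl⟩; exact norm_nonneg _⟩ ⟨v, hv, rfl⟩

/-- Lower bound for the distance function by duality. -/
theorem inner_sub_le_distFun_mul {T : ℝ} (u G φ : L2 T) {R b : ℝ} (hR : 0 ≤ R)
    (hb : 0 < b) (hφ : ‖φ‖ ≤ b) :
    (inner ℝ φ G - R * ‖volterraOp u φ‖) / b ≤ distFun u G R := by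
  refine le_csInf ⟨_, 0, by simpa using hR, rfl⟩ ?_
  rintro _ ⟨v, hv, rfl⟩
  rw [div_le_iff₀ hb]
  have h1 : inner ℝ φ (G - ContinuousLinearMap.adjoint (volterraOp u) v) =
      inner ℝ φ G - inner ℝ (volterraOp u φ) v := by
    rw [inner_sub_right, ContinuousLinearMap.adjoint_inner_right]
  have h2 := real_inner_le_norm φ (G - ContinuousLinearMap.adjoint (volterraOp u) v)
  have h3 := real_inner_le_norm (volterraOp u φ) v
  have h4 : ‖volterraOp u φ‖ * ‖v‖ ≤ ‖volterraOp u φ‖ * R := by gcongr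
  have h5 : ‖φ‖ * ‖G - ContinuousLinearMap.adjoint (volterraOp u) v‖ ≤
      b * ‖G - ContinuousLinearMap.adjoint (volterraOp u) v‖ := by gcongr
  nlinarith

/-! ### Indicators: norms, pairings and primitives -/

/-- The indicator function of `(a, b]` as an element of `L²([0, T], ℝ)`. -/
noncomputable def indIoc (T a b : ℝ) : L2 T :=
  indicatorConstLp 2 (measurableSet_Ioc (a := a) (b := b)) (measure_ne_top (leb T) _) 1

theorem indIoc_coeFn (T a b : ℝ) : indIoc T a b =ᵐ[leb T] (Ioc a b).indicator fun _ => 1 :=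
  indicatorConstLp_coeFn

theorem leb_restrict_Ioc {T a b : ℝ} (ha : 0 ≤ a) (hb : b ≤ T) :
    (leb T).restrict (Ioc a b) = volume.restrict (Ioc a b) := by
  rw [Measure.restrict_restrict measurableSet_Ioc, inter_eq_left.2]
  exact fun t ht => ⟨ha.trans ht.1.le, ht.2.trans hb⟩

theorem norm_sq_of_ae_eq_indicator {T a b : ℝ} (ha : 0 ≤ a) (hab : a ≤ b) (hb : b ≤ T)
    {x : L2 T} {g : ℝ → ℝ} (hx : x =ᵐ[leb T] (Ioc a b).indicator g) :
    ‖x‖ ^ 2 = ∫ t in a..b, g t ^ 2 := by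
  rw [← real_inner_self_eq_norm_sq, L2.inner_def, intervalIntegral.integral_of_le hab,
    ← leb_restrict_Ioc ha hb, ← integral_indicator measurableSet_Ioc]
  refine integral_congr_ae ?_
  filter_upwards [hx] with t ht
  rw [ht]
  by_cases h : t ∈ Ioc a b <;> simp [h, sq]

theorem norm_indIoc {T a b : ℝ} (ha : 0 ≤ a) (hab : a ≤ b) (hb : b ≤ T) :
    ‖indIoc T a b‖ = √(b - a) := by
  rw [← Real.sqrt_sq (norm_nonneg (indIoc T a b)),
    norm_sq_of_ae_eq_indicator ha hab hb (indIoc_coeFn T a b)]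
  simp

theorem inner_indIoc {T a b : ℝ} (ha : 0 ≤ a) (hab : a ≤ b) (hb : b ≤ T) (f : L2 T) :
    inner ℝ (indIoc T a b) f = ∫ t in a..b, f t := by
  rw [indIoc, L2.inner_indicatorConstLp_one, leb_restrict_Ioc ha hb,
    intervalIntegral.integral_of_le hab]

/-- The primitive at `t` is the length of `(a, b] ∩ (0, t]`. -/
theorem volterraOp_indIoc {T a b : ℝ} {u : L2 T} (hu : ∀ᵐ t ∂leb T, u t = 1) (ha : 0 ≤ a)
    (hab : a ≤ b) : ∀ᵐ t ∂leb T, volterraOp u (indIoc T a b) t = min t b - min t a := by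
  filter_upwards [volterraOp_ae_eq_primitive hu (indIoc T a b),
    ae_restrict_mem measurableSet_Icc] with t h ht
  have h1 : ∫ s in (0 : ℝ)..t, indIoc T a b s =
      ∫ s in Ioc 0 t, (Ioc a b).indicator (fun _ => (1 : ℝ)) s := by
    rw [intervalIntegral.integral_of_le ht.1]
    exact integral_congr_ae (ae_mono (restrict_Ioc_le ht) (indIoc_coeFn T a b))
  rw [h, h1, integral_indicator measurableSet_Ioc, Measure.restrict_restrict measurableSet_Ioc,
    Ioc_inter_Ioc, sup_eq_left.2 ha]
  simp only [integral_const, MeasurableSet.univ, measureReal_restrict_apply, univ_inter,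
    Real.volume_real_Ioc, smul_eq_mul, mul_one]
  rcases le_total t a with h | h <;> rcases le_total t b with h' | h' <;>
    simp [h, h', hab]
  all_goals linarith

theorem norm_le_of_ae_le_indIoc {T a b K : ℝ} (ha : 0 ≤ a) (hab : a ≤ b) (hb : b ≤ T)
    (hK : 0 ≤ K) {x : L2 T} (hx : ∀ᵐ t ∂leb T, |x t| ≤ K * (Ioc a b).indicator (fun _ => 1) t) :
    ‖x‖ ≤ K * √(b - a) := by
  have h : ‖x‖ ≤ ‖K • indIoc T a b‖ := by
    refine Lp.norm_le_norm_of_ae_le ?_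
    filter_upwards [hx, Lp.coeFn_smul K (indIoc T a b), indIoc_coeFn T a b] with t h1 h2 h3
    rw [h2, Pi.smul_apply, h3, smul_eq_mul, Real.norm_eq_abs, Real.norm_eq_abs]
    exact h1.trans (le_abs_self _)
  rwa [norm_smul, norm_indIoc ha hab hb, Real.norm_of_nonneg hK] at h

theorem inner_indIoc_rpow {T α b : ℝ} (hα : α < 1) {G : L2 T}
    (hG : ∀ᵐ t ∂leb T, G t = t ^ (-α)) (h0 : 0 ≤ b) (hb : b ≤ T) :
    inner ℝ (indIoc T 0 b) G = b ^ (1 - α) / (1 - α) := by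
  have h : ∫ t in (0 : ℝ)..b, G t = ∫ t in (0 : ℝ)..b, t ^ (-α) := by
    rw [intervalIntegral.integral_of_le h0, intervalIntegral.integral_of_le h0]
    exact integral_congr_ae (ae_mono (restrict_Ioc_le ⟨h0, hb⟩) hG)
  rw [inner_indIoc le_rfl h0 hb, h, integral_rpow (Or.inl (by linarith)),
    show -α + 1 = 1 - α by ring, Real.zero_rpow (by linarith), sub_zero]

/-! ### Test functions and the lower bound -/

/-- For `α > 0` the singularity at the origin is detected by the Haar function of `(0, δ]`. -/
theorem exists_test_of_pos {T α : ℝ} (hα0 : 0 < α) (hα : α < 1) {G u : L2 T}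
    (hG : ∀ᵐ t ∂leb T, G t = t ^ (-α)) (hu : ∀ᵐ t ∂leb T, u t = 1) :
    ∃ c > 0, ∀ δ, 0 < δ → δ ≤ T → ∃ φ : L2 T,
      ‖φ‖ ≤ √δ ∧ c * δ ^ (1 - α) ≤ inner ℝ φ G ∧ ‖volterraOp u φ‖ ≤ δ * √δ := by
  -- This quantity is `2 ^ α - 1`; it vanishes at `α = 0`, where the Haar function is orthogonal to
  -- constants.
  have hc : (0 : ℝ) < 2 * (1 / 2) ^ (1 - α) - 1 := by
    have h : (1 / 2 : ℝ) ^ (1 : ℝ) < (1 / 2) ^ (1 - α) :=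
      Real.rpow_lt_rpow_of_exponent_gt (by norm_num) (by norm_num) (by linarith)
    rw [Real.rpow_one] at h
    linarith
  refine ⟨(2 * (1 / 2) ^ (1 - α) - 1) / (1 - α), div_pos hc (by linarith), fun δ h0 hδ => ?_⟩
  -- This is `1` on `(0, δ/2]` and `-1` on `(δ/2, δ]`. Its mean is zero, so its primitive is a tent
  -- supported in `[0, δ]`; the height bound `δ` used below is crude.
  refine ⟨(2 : ℝ) • indIoc T 0 (δ / 2) - indIoc T 0 δ, ?_, ?_, ?_⟩
  · have := norm_le_of_ae_le_indIoc (x := (2 : ℝ) • indIoc T 0 (δ / 2) - indIoc T 0 δ)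
      le_rfl h0.le hδ zero_le_one (by
        filter_upwards [Lp.coeFn_sub ((2 : ℝ) • indIoc T 0 (δ / 2)) (indIoc T 0 δ),
          Lp.coeFn_smul (2 : ℝ) (indIoc T 0 (δ / 2)), indIoc_coeFn T 0 (δ / 2),
          indIoc_coeFn T 0 δ] with t h1 h2 h3 h4
        rw [h1, Pi.sub_apply, h2, Pi.smul_apply, h3, h4]
        by_cases ha : t ∈ Ioc 0 (δ / 2)
        · have hb : t ∈ Ioc 0 δ := ⟨ha.1, by linarith [ha.2]⟩
          simp only [ha, hb, indicator_of_mem]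
          norm_num
        · by_cases hb : t ∈ Ioc 0 δ <;>
            simp only [ha, hb, indicator_of_mem, indicator_of_notMem, not_false_eq_true] <;>
            norm_num)
    simpa using this
  · rw [inner_sub_left, real_inner_smul_left, inner_indIoc_rpow hα hG (by linarith) (by linarith),
      inner_indIoc_rpow hα hG h0.le hδ, show δ / 2 = 1 / 2 * δ by ring,
      Real.mul_rpow (by norm_num) h0.le]
    exact le_of_eq (by ring)
  · have := norm_le_of_ae_le_indIoc
      (x := volterraOp u ((2 : ℝ) • indIoc T 0 (δ / 2) - indIoc T 0 δ))
      le_rfl h0.le hδ h0.le (by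
        rw [map_sub, map_smul]
        filter_upwards [Lp.coeFn_sub ((2 : ℝ) • volterraOp u (indIoc T 0 (δ / 2)))
            (volterraOp u (indIoc T 0 δ)),
          Lp.coeFn_smul (2 : ℝ) (volterraOp u (indIoc T 0 (δ / 2))),
          volterraOp_indIoc hu le_rfl (show 0 ≤ δ / 2 by linarith),
          volterraOp_indIoc hu le_rfl h0.le, ae_restrict_mem measurableSet_Icc,
          ae_restrict_of_ae (Measure.ae_ne volume (0 : ℝ))] with t h1 h2 h3 h4 ht ht0
        have hpos : 0 < t := lt_of_le_of_ne ht.1 (Ne.symm ht0)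
        rw [h1, Pi.sub_apply, h2, Pi.smul_apply, h3, h4, smul_eq_mul, min_eq_right ht.1]
        by_cases hb : t ≤ δ
        · rw [indicator_of_mem (show t ∈ Ioc 0 δ from ⟨hpos, hb⟩), min_eq_left hb, abs_le]
          rcases le_total t (δ / 2) with h | h
          · rw [min_eq_left h]; constructor <;> linarith
          · rw [min_eq_right h]; constructor <;> linarith
        · rw [indicator_of_notMem (fun h => hb h.2), min_eq_right (by linarith),
            min_eq_right (by linarith), sub_zero, sub_zero, mul_div_cancel₀ _ two_ne_zero]
          simp)
    simpa using this

/-- For the constant function the obstruction is the vanishing boundary value at `T`. -/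
theorem exists_test_of_one {T : ℝ} {G u : L2 T}
    (hG : ∀ᵐ t ∂leb T, G t = 1) (hu : ∀ᵐ t ∂leb T, u t = 1) {δ : ℝ} (h0 : 0 < δ) (hδ : δ ≤ T) :
    ∃ φ : L2 T, ‖φ‖ ≤ √δ ∧ δ ≤ inner ℝ φ G ∧ ‖volterraOp u φ‖ ≤ δ * √δ := by
  have ha : 0 ≤ T - δ := by linarith
  have hab : T - δ ≤ T := by linarith
  refine ⟨indIoc T (T - δ) T, ?_, ?_, ?_⟩
  · rw [norm_indIoc ha hab le_rfl, sub_sub_cancel]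
  · have h : ∫ t in (T - δ)..T, G t = ∫ t in (T - δ)..T, (1 : ℝ) := by
      rw [intervalIntegral.integral_of_le hab, intervalIntegral.integral_of_le hab,
        ← leb_restrict_Ioc ha le_rfl]
      exact integral_congr_ae (ae_restrict_of_ae hG)
    rw [inner_indIoc ha hab le_rfl, h]
    simp
  -- No cancellation is needed here: the primitive starts at `T - δ` and the interval ends at `T`.
  · have := norm_le_of_ae_le_indIoc (x := volterraOp u (indIoc T (T - δ) T)) ha hab le_rfl h0.le
      (by
        filter_upwards [volterraOp_indIoc hu ha hab, ae_restrict_mem measurableSet_Icc]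
          with t h ht
        rw [h, min_eq_left ht.2]
        by_cases hb : t ≤ T - δ
        · rw [indicator_of_notMem (fun h => hb.not_gt h.1), min_eq_left hb]
          simp
        · rw [indicator_of_mem (show t ∈ Ioc (T - δ) T from ⟨not_le.1 hb, ht.2⟩),
            min_eq_right (by linarith), abs_of_nonneg (by linarith)]
          linarith [ht.2])
    simpa using this

/-- Both obstructions obey the same scaling in `δ`, so one balancing argument serves for `α = 0`
(endpoint `T`) and `α > 0` (origin). -/
theorem exists_test {T α : ℝ} (hα0 : 0 ≤ α) (hα : α < 1) {G u : L2 T}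
    (hG : ∀ᵐ t ∂leb T, G t = t ^ (-α)) (hu : ∀ᵐ t ∂leb T, u t = 1) :
    ∃ c > 0, ∀ δ, 0 < δ → δ ≤ T → ∃ φ : L2 T,
      ‖φ‖ ≤ √δ ∧ c * δ ^ (1 - α) ≤ inner ℝ φ G ∧ ‖volterraOp u φ‖ ≤ δ * √δ := by
  rcases hα0.eq_or_lt with rfl | hpos
  · refine ⟨1, one_pos, fun δ h0 hδ => ?_⟩
    simpa using exists_test_of_one (by simpa using hG) hu h0 hδ
  · exact exists_test_of_pos hpos hα hG hu

/-- The distance function decays no faster than `R ^ (-(1 - 2α) / (1 + 2α))`. -/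
theorem distFun_lower_bound {T α : ℝ} (hT : 0 < T) (hα0 : 0 ≤ α) (hα : α < 1) {G u : L2 T}
    (hG : ∀ᵐ t ∂leb T, G t = t ^ (-α)) (hu : ∀ᵐ t ∂leb T, u t = 1) :
    ∃ C > 0, ∀ᶠ R : ℝ in atTop, C * R ^ (-((1 - 2 * α) / (1 + 2 * α))) ≤ distFun u G R := by
  obtain ⟨c, hc, hφ⟩ := exists_test hα0 hα hG hu
  have hγ : 0 < 1 + 2 * α := by linarith
  set p := (1 - 2 * α) / (1 + 2 * α) with hp
  have hlim : Tendsto (fun R : ℝ => (c / 2 / R) ^ (2 / (1 + 2 * α))) atTop (nhds 0) := by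
    have h := ((tendsto_const_nhds (x := c / 2)).div_atTop tendsto_id).rpow_const
      (p := 2 / (1 + 2 * α)) (Or.inr (by positivity))
    simpa [Real.zero_rpow (show 2 / (1 + 2 * α) ≠ 0 by positivity)] using h
  refine ⟨c / 2 * (c / 2) ^ p, by positivity, ?_⟩
  filter_upwards [hlim.eventually_le_const hT, eventually_gt_atTop 0] with R hRT hR
  have hr : 0 < c / 2 / R := by positivity
  -- The scale `δ` solves `R * δ ^ (3/2) = c / 2 * δ ^ (1 - α)`, so the penalty uses at most half of
  -- the pairing.
  set r := c / 2 / R with hr_def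
  set δ := r ^ (2 / (1 + 2 * α)) with hδ_def
  have hδ : 0 < δ := by positivity
  obtain ⟨φ, h1, h2, h3⟩ := hφ δ hδ hRT
  refine le_trans ?_ (inner_sub_le_distFun_mul u G φ hR.le (Real.sqrt_pos.2 hδ) h1)
  rw [le_div_iff₀ (Real.sqrt_pos.2 hδ)]
  have hp1 : r ^ p * √δ = δ ^ (1 - α) := by
    rw [Real.sqrt_eq_rpow, hδ_def, ← Real.rpow_mul hr.le, ← Real.rpow_mul hr.le,
      ← Real.rpow_add hr]
    congr 1
    rw [hp]; field_simp; ring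
  have hp2 : r ^ p * r = δ := by
    rw [hδ_def, ← Real.rpow_add_one hr.ne']
    congr 1
    rw [hp]; field_simp; ring
  have hp3 : (c / 2) ^ p * R ^ (-p) = r ^ p := by
    rw [hr_def, Real.div_rpow (by positivity) hR.le, Real.rpow_neg hR.le, ← div_eq_mul_inv]
  have hRr : R * r = c / 2 := by rw [hr_def]; field_simp
  have h4 : R * ‖volterraOp u φ‖ ≤ c / 2 * δ ^ (1 - α) := by
    calc R * ‖volterraOp u φ‖ ≤ R * (δ * √δ) := by gcongr
      _ = (R * r) * (r ^ p * √δ) := by nth_rewrite 1 [← hp2]; ring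
      _ = _ := by rw [hRr, hp1]
  have h5 : c / 2 * (c / 2) ^ p * R ^ (-p) * √δ = c / 2 * δ ^ (1 - α) := by
    rw [← hp1, ← hp3]; ring
  rw [h5]
  linarith

/-! ### Approximants and the upper bound -/

theorem integral_left_of_ae_eq_indicator {T a s : ℝ} {v : L2 T} {g : ℝ → ℝ} (ha : a ≤ T)
    (hs : s ∈ Icc 0 T) (hv : v =ᵐ[leb T] (Ioc a T).indicator g) :
    ∫ t in s..T, v t = ∫ t in (max a s)..T, g t := by
  rw [intervalIntegral.integral_of_le hs.2, intervalIntegral.integral_of_le (max_le ha hs.2)]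
  have hle : volume.restrict (Ioc s T) ≤ leb T :=
    Measure.restrict_mono_set volume
      (show Ioc s T ⊆ Icc 0 T from fun t ht => ⟨hs.1.trans ht.1.le, ht.2⟩)
  rw [integral_congr_ae (ae_mono hle hv), integral_indicator measurableSet_Ioc,
    Measure.restrict_restrict measurableSet_Ioc, Ioc_inter_Ioc, inf_idem]

/-- With `a = T - η` and division by `η`, this is the ramp equal to `1` up to `T - η` and falling
linearly to `0` at `T`. -/
theorem adjoint_volterraOp_indIoc {T a : ℝ} (hT : 0 ≤ T) {u : L2 T}
    (hu : ∀ᵐ t ∂leb T, u t = 1) (ha : a ≤ T) :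
    ∀ᵐ s ∂leb T, ContinuousLinearMap.adjoint (volterraOp u) (indIoc T a T) s = T - max a s := by
  filter_upwards [adjoint_volterraOp_ae_eq_primitive hT hu (indIoc T a T),
    ae_restrict_mem measurableSet_Icc] with s h hs
  rw [h, integral_left_of_ae_eq_indicator ha hs (indIoc_coeFn T a T)]
  simp

/-- The integrand is the derivative of `-t ^ (-α)`; keeping the factor `α` inside lets `α = 0` be
included. -/
theorem integral_mul_rpow_neg_sub_one {α a b : ℝ} (ha : 0 < a) (hb : 0 < b) :
    ∫ t in a..b, α * t ^ (-α - 1) = a ^ (-α) - b ^ (-α) := by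
  rcases eq_or_ne α 0 with rfl | hα
  · simp
  · rw [intervalIntegral.integral_const_mul, integral_rpow
      (Or.inr ⟨fun h => hα (by linarith), notMem_uIcc_of_lt ha hb⟩), sub_add_cancel]
    field_simp
    ring

/-- The function `v` whose backward primitive is `t ↦ max δ t ^ (-α) - T ^ (-α)`. -/
theorem exists_adjoint_eq_truncated_rpow {T α δ : ℝ} (hα0 : 0 ≤ α) (hα : α ≤ 1 / 2) {u : L2 T}
    (hu : ∀ᵐ t ∂leb T, u t = 1) (hδ : 0 < δ) (hδT : δ ≤ T) :
    ∃ v : L2 T, ‖v‖ ≤ δ ^ (-(1 + 2 * α) / 2) / 2 ∧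
      ∀ᵐ s ∂leb T, ContinuousLinearMap.adjoint (volterraOp u) v s =
        max δ s ^ (-α) - T ^ (-α) := by
  have hT : 0 < T := hδ.trans_le hδT
  have hmem : MemLp ((Ioc δ T).indicator fun t => α * t ^ (-α - 1)) 2 (leb T) := by
    refine MemLp.of_bound (C := α * δ ^ (-α - 1)) ?_ ?_
    · exact (Measurable.indicator (by fun_prop) measurableSet_Ioc).aestronglyMeasurable
    · refine Eventually.of_forall fun t => ?_
      by_cases ht : t ∈ Ioc δ T
      · have h0 : 0 < t := hδ.trans ht.1
        rw [indicator_of_mem ht, Real.norm_of_nonneg (by positivity)]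
        exact mul_le_mul_of_nonneg_left
          (Real.rpow_le_rpow_of_nonpos hδ ht.1.le (by linarith)) hα0
      · rw [indicator_of_notMem ht, norm_zero]
        positivity
  refine ⟨hmem.toLp _, ?_, ?_⟩
  · refine (sq_le_sq₀ (norm_nonneg _) (by positivity)).1 ?_
    rw [norm_sq_of_ae_eq_indicator hδ.le hδT le_rfl hmem.coeFn_toLp]
    have h1 : ∫ t in δ..T, (α * t ^ (-α - 1)) ^ 2 = ∫ t in δ..T, α ^ 2 * t ^ (-2 * α - 2) := by
      refine intervalIntegral.integral_congr fun t ht => ?_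
      rw [uIcc_of_le hδT] at ht
      have h0 : 0 < t := hδ.trans_le ht.1
      rw [mul_pow, ← Real.rpow_natCast (t ^ (-α - 1)), ← Real.rpow_mul h0.le]
      congr 2
      push_cast
      ring
    rw [h1, intervalIntegral.integral_const_mul, integral_rpow
      (Or.inr ⟨fun h => by linarith, notMem_uIcc_of_lt hδ hT⟩)]
    have h2 : (δ ^ (-(1 + 2 * α) / 2) / 2) ^ 2 = δ ^ (-2 * α - 2 + 1) / 4 := by
      rw [div_pow, ← Real.rpow_natCast (δ ^ _), ← Real.rpow_mul hδ.le]
      norm_num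
      congr 1
      ring
    -- The squared norm is at most `α ^ 2 / (1 + 2α) * δ ^ (-1 - 2α)`, and `α ≤ 1/2` bounds the
    -- coefficient by `1/4`.
    rw [h2, ← mul_div_assoc, div_le_iff_of_neg (by linarith)]
    have h3 : 0 < δ ^ (-2 * α - 2 + 1) := by positivity
    have h4 : 0 < T ^ (-2 * α - 2 + 1) := by positivity
    have h5 : α ^ 2 ≤ 1 / 4 := by nlinarith
    nlinarith [mul_nonneg (sq_nonneg α) h4.le, mul_nonneg hα0 h3.le,
      mul_nonneg (sub_nonneg.2 h5) h3.le]
  · filter_upwards [adjoint_volterraOp_ae_eq_primitive hT.le hu (hmem.toLp _),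
      ae_restrict_mem measurableSet_Icc] with s h hs
    rw [h, integral_left_of_ae_eq_indicator hδT hs hmem.coeFn_toLp,
      integral_mul_rpow_neg_sub_one (hδ.trans_le (le_max_left _ _)) hT]

/-- This piece dominates the error of freezing the power on `(0, δ]`. Its squared norm is `δ ^ (1 -
2α) / (1 - 2α)`, finite because `α < 1/2`. -/
theorem exists_truncated_rpow_near_zero {T α δ : ℝ} (hα : α < 1 / 2) {G : L2 T}
    (hG : ∀ᵐ t ∂leb T, G t = t ^ (-α)) (hδ : 0 < δ) (hδT : δ ≤ T) :
    ∃ e : L2 T, ‖e‖ = (√(1 - 2 * α))⁻¹ * δ ^ ((1 - 2 * α) / 2) ∧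
      e =ᵐ[leb T] (Ioc 0 δ).indicator fun t => t ^ (-α) := by
  have hmem := (Lp.memLp G).indicator (measurableSet_Ioc (a := 0) (b := δ))
  have he : hmem.toLp _ =ᵐ[leb T] (Ioc 0 δ).indicator fun t => t ^ (-α) := by
    filter_upwards [hmem.coeFn_toLp, hG] with t h1 h2
    rw [h1]
    by_cases ht : t ∈ Ioc 0 δ <;> simp [ht, h2]
  refine ⟨hmem.toLp _, ?_, he⟩
  rw [← sq_eq_sq₀ (norm_nonneg _) (by positivity),
    norm_sq_of_ae_eq_indicator le_rfl hδ.le hδT he]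
  have h1 : ∫ t in (0 : ℝ)..δ, (t ^ (-α)) ^ 2 = ∫ t in (0 : ℝ)..δ, t ^ (-2 * α) := by
    refine intervalIntegral.integral_congr fun t ht => ?_
    rw [uIcc_of_le hδ.le] at ht
    rw [← Real.rpow_natCast (t ^ (-α)), ← Real.rpow_mul ht.1]
    congr 1
    push_cast
    ring
  rw [h1, integral_rpow (Or.inl (by linarith)), Real.zero_rpow (by linarith), mul_pow, inv_pow,
    Real.sq_sqrt (by linarith), ← Real.rpow_natCast (δ ^ _), ← Real.rpow_mul hδ.le]
  rw [show (1 - 2 * α) / 2 * ((2 : ℕ) : ℝ) = -2 * α + 1 by push_cast; ring,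
    show 1 - 2 * α = -2 * α + 1 by ring]
  rw [sub_zero, div_eq_inv_mul]

/-- The approximant of `t ^ (-α)` that is constant on `(0, δ]` and has a linear boundary layer
of width `η` at `T`. -/
theorem exists_approximant {T α δ η : ℝ} (hα0 : 0 ≤ α) (hα : α < 1 / 2) {G u : L2 T}
    (hG : ∀ᵐ t ∂leb T, G t = t ^ (-α)) (hu : ∀ᵐ t ∂leb T, u t = 1)
    (hδ : 0 < δ) (hδT : δ ≤ T) (hη : 0 < η) (hηT : η ≤ T) :
    ∃ v : L2 T, ‖v‖ ≤ δ ^ (-(1 + 2 * α) / 2) / 2 + T ^ (-α) / √η ∧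
      ‖G - ContinuousLinearMap.adjoint (volterraOp u) v‖ ≤
        (√(1 - 2 * α))⁻¹ * δ ^ ((1 - 2 * α) / 2) + T ^ (-α) * √η := by
  have hT : 0 < T := hδ.trans_le hδT
  have ha : 0 ≤ T - η := by linarith
  have hab : T - η ≤ T := by linarith
  obtain ⟨v, hv, hadj⟩ := exists_adjoint_eq_truncated_rpow hα0 hα.le hu hδ hδT
  obtain ⟨e, he, hee⟩ := exists_truncated_rpow_near_zero hα hG hδ hδT
  have hnorm := norm_indIoc ha hab le_rfl
  rw [sub_sub_cancel] at hnorm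
  refine ⟨v + (T ^ (-α) / η) • indIoc T (T - η) T, ?_, ?_⟩
  · refine (norm_add_le _ _).trans (add_le_add hv (le_of_eq ?_))
    rw [norm_smul, hnorm, Real.norm_of_nonneg (by positivity), div_mul_eq_mul_div, mul_div_assoc,
      Real.sqrt_div_self, ← div_eq_mul_inv]
  -- The residual splits into the truncation error near `0` and `T ^ (-α)` times one minus the ramp.
  -- Both are nonnegative, so a pointwise majorant suffices.
  · have h : ‖G - ContinuousLinearMap.adjoint (volterraOp u)
        (v + (T ^ (-α) / η) • indIoc T (T - η) T)‖ ≤ ‖e + T ^ (-α) • indIoc T (T - η) T‖ := by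
      rw [map_add, map_smul]
      refine Lp.norm_le_norm_of_ae_le ?_
      filter_upwards [Lp.coeFn_sub G (ContinuousLinearMap.adjoint (volterraOp u) v +
          (T ^ (-α) / η) • ContinuousLinearMap.adjoint (volterraOp u) (indIoc T (T - η) T)),
        Lp.coeFn_add (ContinuousLinearMap.adjoint (volterraOp u) v)
          ((T ^ (-α) / η) • ContinuousLinearMap.adjoint (volterraOp u) (indIoc T (T - η) T)),
        Lp.coeFn_smul (T ^ (-α) / η)
          (ContinuousLinearMap.adjoint (volterraOp u) (indIoc T (T - η) T)),
        adjoint_volterraOp_indIoc hT.le hu hab, hadj, hG, hee,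
        Lp.coeFn_add e (T ^ (-α) • indIoc T (T - η) T),
        Lp.coeFn_smul (T ^ (-α)) (indIoc T (T - η) T), indIoc_coeFn T (T - η) T,
        ae_restrict_mem measurableSet_Icc,
        ae_restrict_of_ae (Measure.ae_ne volume (0 : ℝ))]
        with s h1 h2 h3 h4 h5 h6 h7 h8 h9 h10 hs hs0
      have hpos : 0 < s := lt_of_le_of_ne hs.1 (Ne.symm hs0)
      rw [h1, Pi.sub_apply, h2, Pi.add_apply, h3, Pi.smul_apply, h4, h5, h6, h8, Pi.add_apply, h7,
        h9, Pi.smul_apply, h10, smul_eq_mul, smul_eq_mul, Real.norm_eq_abs, Real.norm_eq_abs]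
      have hTα : 0 < T ^ (-α) := by positivity
      have hA : 0 ≤ s ^ (-α) - max δ s ^ (-α) ∧ s ^ (-α) - max δ s ^ (-α) ≤
          (Ioc 0 δ).indicator (fun t => t ^ (-α)) s := by
        rcases le_or_gt s δ with h | h
        · rw [max_eq_left h, indicator_of_mem (show s ∈ Ioc 0 δ from ⟨hpos, h⟩)]
          have := Real.rpow_le_rpow_of_nonpos hpos h (neg_nonpos.2 hα0)
          have := Real.rpow_pos_of_pos hδ (-α)
          constructor <;> linarith
        · rw [max_eq_right h.le, indicator_of_notMem (fun h' => h.not_ge h'.2), sub_self]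
          exact ⟨le_rfl, le_rfl⟩
      have hB : 0 ≤ T ^ (-α) - T ^ (-α) / η * (T - max (T - η) s) ∧
          T ^ (-α) - T ^ (-α) / η * (T - max (T - η) s) ≤
          T ^ (-α) * (Ioc (T - η) T).indicator (fun _ => 1) s := by
        rcases le_or_gt s (T - η) with h | h
        · rw [max_eq_left h, indicator_of_notMem (fun h' => h.not_gt h'.1), sub_sub_cancel,
            div_mul_cancel₀ _ hη.ne', sub_self, mul_zero]
          exact ⟨le_rfl, le_rfl⟩
        · rw [max_eq_right h.le, indicator_of_mem (show s ∈ Ioc (T - η) T from ⟨h, hs.2⟩)]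
          have h11 : 0 ≤ T ^ (-α) / η * (T - s) :=
            mul_nonneg (by positivity) (by linarith [hs.2])
          have h12 : T ^ (-α) / η * (T - s) ≤ T ^ (-α) / η * η := by
            gcongr
            linarith
          rw [div_mul_cancel₀ _ hη.ne'] at h12
          constructor <;> linarith
      rw [abs_of_nonneg (by linarith [hA.1, hB.1])]
      exact le_trans (by linarith [hA.2, hB.2]) (le_abs_self _)
    refine h.trans ((norm_add_le _ _).trans (add_le_add he.le (le_of_eq ?_)))
    rw [norm_smul, hnorm, Real.norm_of_nonneg (by positivity)]

/-- The distance function is `O(R ^ (-(1 - 2α) / (1 + 2α)))`. -/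
theorem distFun_upper_bound {T α : ℝ} (hT : 0 < T) (hα0 : 0 ≤ α) (hα : α < 1 / 2) {G u : L2 T}
    (hG : ∀ᵐ t ∂leb T, G t = t ^ (-α)) (hu : ∀ᵐ t ∂leb T, u t = 1) :
    ∃ C, ∀ᶠ R : ℝ in atTop, distFun u G R ≤ C * R ^ (-((1 - 2 * α) / (1 + 2 * α))) := by
  have hγ : 0 < 1 + 2 * α := by linarith
  have hlim : Tendsto (fun R : ℝ => R ^ (-(2 / (1 + 2 * α)))) atTop (nhds 0) :=
    tendsto_rpow_neg_atTop (by positivity)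
  have hlim' : Tendsto (fun R : ℝ => (2 * T ^ (-α) / R) ^ 2) atTop (nhds 0) := by
    simpa using ((tendsto_const_nhds (x := 2 * T ^ (-α))).div_atTop tendsto_id).pow 2
  refine ⟨(√(1 - 2 * α))⁻¹ + 2 * (T ^ (-α)) ^ 2, ?_⟩
  filter_upwards [hlim.eventually_le_const hT, hlim'.eventually_le_const hT,
    eventually_ge_atTop 1] with R h1 h2 hR1
  have hR : 0 < R := by linarith
  have hTα : 0 < T ^ (-α) := by positivity
  -- `h1` and `h2` fix `δ = R ^ (-2 / (1 + 2α))` and `η = (2 T ^ (-α) / R) ^ 2`, for which each norm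
  -- contribution is `R / 2`.
  obtain ⟨v, hv, hd⟩ := exists_approximant hα0 hα hG hu (by positivity) h1 (by positivity) h2
  rw [Real.sqrt_sq (by positivity), ← Real.rpow_mul hR.le] at hv hd
  have e1 : -(2 / (1 + 2 * α)) * (-(1 + 2 * α) / 2) = 1 := by field_simp
  have e2 : -(2 / (1 + 2 * α)) * ((1 - 2 * α) / 2) = -((1 - 2 * α) / (1 + 2 * α)) := by
    field_simp
  have e3 : T ^ (-α) / (2 * T ^ (-α) / R) = R / 2 := by field_simp
  rw [e1, e3, Real.rpow_one, add_halves] at hv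
  rw [e2] at hd
  refine (distFun_le u G v hv).trans (hd.trans ?_)
  -- The layer error is absorbed because the target exponent is at most `1`, as `α ≥ 0`.
  have h3 : R⁻¹ ≤ R ^ (-((1 - 2 * α) / (1 + 2 * α))) := by
    rw [← Real.rpow_neg_one]
    refine Real.rpow_le_rpow_of_exponent_le hR1 (neg_le_neg ?_)
    rw [div_le_one hγ]
    linarith
  have h4 : T ^ (-α) * (2 * T ^ (-α) / R) = 2 * (T ^ (-α)) ^ 2 * R⁻¹ := by ring
  rw [h4, add_mul]
  gcongr

end PropagatorEstimation

/-! ### The limsup statements -/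

theorem mainTheorem5 (T : ℝ) (hT : 0 < T) (α : ℝ) (hα0 : 0 ≤ α) (hα : α < 1 / 2)
    (G u : PropagatorEstimation.L2 T)
    (hG : ∀ᵐ t ∂PropagatorEstimation.leb T, G t = t ^ (-α))
    (hu : ∀ᵐ t ∂PropagatorEstimation.leb T, u t = 1) :
    Filter.limsup (fun R : ℝ =>
        ((PropagatorEstimation.distFun u G R * R ^ ((1 - 2 * α) / (1 + 2 * α)) : ℝ) : EReal))
      Filter.atTop < ⊤ ∧
    ∀ ε : ℝ, (1 - 2 * α) / (1 + 2 * α) < ε →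
      Filter.limsup (fun R : ℝ =>
        ((PropagatorEstimation.distFun u G R * R ^ ε : ℝ) : EReal)) Filter.atTop = ⊤ := by
  constructor
  · obtain ⟨C, hC⟩ := PropagatorEstimation.distFun_upper_bound hT hα0 hα hG hu
    -- The limsup is taken in `EReal`, so finiteness and infinity carry their literal meaning.
    refine lt_of_le_of_lt (Filter.limsup_le_of_le (a := (C : EReal)) ?_ ?_) (EReal.coe_lt_top C)
    · isBoundedDefault
    · filter_upwards [hC, Filter.eventually_gt_atTop 0] with R h hR
      rw [EReal.coe_le_coe_iff]
      calc _ ≤ C * R ^ (-((1 - 2 * α) / (1 + 2 * α))) * R ^ ((1 - 2 * α) / (1 + 2 * α)) := by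
            gcongr
        _ = C := by rw [mul_assoc, ← Real.rpow_add hR, neg_add_cancel, Real.rpow_zero, mul_one]
  · intro ε hε
    obtain ⟨C, hC0, hC⟩ := PropagatorEstimation.distFun_lower_bound hT hα0 (by linarith) hG hu
    refine Filter.Tendsto.limsup_eq (EReal.tendsto_coe_nhds_top_iff.2 ?_)
    refine Filter.tendsto_atTop_mono' _ ?_
      ((tendsto_rpow_atTop (sub_pos.2 hε)).const_mul_atTop hC0)
    filter_upwards [hC, Filter.eventually_gt_atTop 0] with R h hR
    calc C * R ^ (ε - (1 - 2 * α) / (1 + 2 * α))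
        = C * R ^ (-((1 - 2 * α) / (1 + 2 * α))) * R ^ ε := by
          rw [mul_assoc, ← Real.rpow_add hR]
          congr 2
          ring
      _ ≤ _ := by gcongr
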